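/- Let $m,n\ge 1$, let $\mathbb{P}_m$ be the set of $m\times m$ complex positive definite matrices, let $\mathbb{A}=(A_1,\dots,A_n)\in\mathbb{P}_m^n$, and let $\omega=(w_1,\dots,w_n)$ be a positive probability vector, that is, $w_j>0$ for all $j$ and $\sum_{j=1}^n w_j=1$. Consider the following means. (a) For real $s\neq 0$, the quasi-arithmetic mean is $\mathcal{Q}_s(\omega;\mathbb{A})=\left(\sum_{j=1}^n w_jA_j^s\right)^{1/s}$. (b) For $s\in(0,1]$, the Lim–Pálfia power mean $P_s(\omega;\mathbb{A})$ is the unique $X\in\mathbb{P}_m$ with $X=\sum_{j=1}^n w_j\,(X\#_sA_j)$, where $A\#_sB=A^{1/2}(A^{-1/2}BA^{-1/2})^sA^{1/2}$. (c) For $0<t\le z<1$, the $t$-$z$ Rényi right mean is the unique minimizer $$\Omega_{t,z}(\omega;\mathbb{A})=\underset{X\in\mathbb{P}_m}{\arg\min}\ \sum_{j=1}^n w_j\,\Phi_{t,z}(A_j,X),$$ where $\Phi_{t,z}(A,B)=\operatorname{tr}\big((1-t)A+tB\big)-\operatorname{tr}\left(A^{\frac{1-t}{2z}}B^{\frac{t}{z}}A^{\frac{1-t}{2z}}\right)^z$.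 Let $\Vert\cdot\Vert$ denote the operator norm. Then for $0<t\le z<1$, $$\Vert P_{1-t}(\omega;\mathbb{A})\Vert\le\Vert\Omega_{t,z}(\omega;\mathbb{A})\Vert\le\Vert\mathcal{Q}_{\frac{1-t}{z}}(\omega;\mathbb{A})\Vert.$$ Furthermore, $\Vert\mathcal{Q}_{\frac{t-1}{z}}(\omega;\mathbb{A})\Vert\le\Vert\Omega_{t,z}(\omega;\mathbb{A})\Vert$. -/

import Mathlib

open scoped MatrixOrder Matrix.Norms.L2Operator ComplexOrder

/-- The quasi-arithmetic mean `(∑ⱼ wⱼ Aⱼ ^ s) ^ (1 / s)` of order `s ≠ 0`.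
Real powers of matrices are those of the continuous functional calculus. -/
noncomputable def quasiArithmeticMean {m n : ℕ} (s : ℝ) (w : Fin n → ℝ)
    (A : Fin n → Matrix (Fin m) (Fin m) ℂ) : Matrix (Fin m) (Fin m) ℂ :=
  (∑ j, w j • (A j) ^ s) ^ (1 / s)

/-- The weighted geometric mean `A #ₛ B = A^{1/2} (A^{-1/2} B A^{-1/2})^s A^{1/2}`. -/
noncomputable def weightedGeometricMean {m : ℕ} (s : ℝ)
    (A B : Matrix (Fin m) (Fin m) ℂ) : Matrix (Fin m) (Fin m) ℂ :=
  A ^ (1 / 2 : ℝ) * (A ^ (-(1 / 2) : ℝ) * B * A ^ (-(1 / 2) : ℝ)) ^ s * A ^ (1 / 2 : ℝ)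

/-- `X` is a positive definite solution of `X = ∑ⱼ wⱼ (X #ₛ Aⱼ)`. -/
def IsPowerMean {m n : ℕ} (s : ℝ) (w : Fin n → ℝ)
    (A : Fin n → Matrix (Fin m) (Fin m) ℂ) (X : Matrix (Fin m) (Fin m) ℂ) : Prop :=
  X.PosDef ∧ X = ∑ j, w j • weightedGeometricMean s X (A j)

/-- The Lim–Pálfia power mean of order `s ∈ (0, 1]`: the (unique) positive definite solution `X`
of `X = ∑ⱼ wⱼ (X #ₛ Aⱼ)`. -/
noncomputable def powerMean {m n : ℕ} (s : ℝ) (w : Fin n → ℝ)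
    (A : Fin n → Matrix (Fin m) (Fin m) ℂ) : Matrix (Fin m) (Fin m) ℂ :=
  Classical.epsilon (IsPowerMean s w A)

/-- The matrix `t`-`z` Rényi relative entropy
`Q_{t,z}(A, B) = (A^{(1-t)/(2z)} B^{t/z} A^{(1-t)/(2z)})^z`. -/
noncomputable def renyiEntropy {m : ℕ} (t z : ℝ)
    (A B : Matrix (Fin m) (Fin m) ℂ) : Matrix (Fin m) (Fin m) ℂ :=
  (A ^ ((1 - t) / (2 * z)) * B ^ (t / z) * A ^ ((1 - t) / (2 * z))) ^ z

/-- The `t`-`z` Bures–Wasserstein quantum divergence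
`Φ_{t,z}(A, B) = tr((1-t)A + tB) - tr Q_{t,z}(A, B)`. Both traces are real
when `A` and `B` are positive definite. -/
noncomputable def buresWassersteinDivergence {m : ℕ} (t z : ℝ)
    (A B : Matrix (Fin m) (Fin m) ℂ) : ℝ :=
  ((1 - t) • A + t • B).trace.re - (renyiEntropy t z A B).trace.re

/-- `X` minimizes `∑ⱼ wⱼ Φ_{t,z}(Aⱼ, X)` over the positive definite matrices. -/
def IsRenyiRightMean {m n : ℕ} (t z : ℝ) (w : Fin n → ℝ)
    (A : Fin n → Matrix (Fin m) (Fin m) ℂ) (X : Matrix (Fin m) (Fin m) ℂ) : Prop :=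
  X.PosDef ∧
    IsMinOn (fun Y => ∑ j, w j * buresWassersteinDivergence t z (A j) Y) {Y | Y.PosDef} X

/-- The `t`-`z` Rényi right mean: the (unique) minimizer of `∑ⱼ wⱼ Φ_{t,z}(Aⱼ, X)` over the
positive definite matrices `X`. -/
noncomputable def renyiRightMean {m n : ℕ} (t z : ℝ) (w : Fin n → ℝ)
    (A : Fin n → Matrix (Fin m) (Fin m) ℂ) : Matrix (Fin m) (Fin m) ℂ :=
  Classical.epsilon (IsRenyiRightMean t z w A)

/-! With Y = X^(t/z) and R_j = A_j^((1-t)/(2z)), the Rényi problem becomes, up to a constant,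
minimizing t tr Y^(z/t) - ∑ w_j tr (R_j Y R_j)^z. This is convex because t ≤ z ≤ 1, and a minimizer
satisfies X^(1-t/z) = ∑ w_j R_j (R_j X^(t/z) R_j)^(z-1) R_j (`IsRenyiRightMean.rpow_eq`). All three
bounds follow from this equation; put x = ‖X‖.

Lower bounds: X^(t/z) ≤ x^(t/z) and the power z - 1 reverses order, so ∑ w_j A_j^(1-t) ≤ x^(1-t)
(`IsRenyiRightMean.sum_rpow_le`). For the power mean, comparing its fixed point with a scalar matrix
then suffices (`IsPowerMean.norm_le`); for the quasi-arithmetic mean of negative order, operator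
convexity of the inverse and operator concavity of the z-th power do
(`norm_quasiArithmeticMean_le`).

Upper bound: conjugating by S = X^(t/(2z)) gives X = ∑ w_j (S A_j^((1-t)/z) S)^z ≤ (S N S)^z with N
= ∑ w_j A_j^((1-t)/z), hence x ≤ ‖N‖^z x^t.

The means are chosen by `Classical.epsilon`, so existence of both must be proved, while uniqueness
plays no role. The minimizer exists because truncating the spectrum confines the problem to a
compact order interval; the power mean exists as a fixed point of a monotone map on such an
interval. -/

/-! ### Real powers of positive matrices and bounds for the gradient of tr (R Y R)^z -/

section MatrixPowers

variable {ι : Type*} [Fintype ι] [DecidableEq ι]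

/-- Two Hermitian matrices intertwined by `K` have their functional calculi intertwined by `K`. -/
theorem Matrix.cfc_mul_eq_mul_cfc {A B K : Matrix ι ι ℂ} (hA : IsSelfAdjoint A)
    (hB : IsSelfAdjoint B) (h : A * K = K * B) (f : ℝ → ℝ) :
    cfc f A * K = K * cfc f B := by
  have hfin : (spectrum ℝ A ∪ spectrum ℝ B).Finite :=
    Matrix.finite_real_spectrum.union Matrix.finite_real_spectrum
  -- A single polynomial interpolating `f` on both spectra computes both functional calculi, which
  -- reduces the claim to monomials.
  set S := hfin.toFinset with hS
  set p := Lagrange.interpolate S id f with hp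
  have hpf : ∀ x ∈ S, p.eval x = f x := fun x hx =>
    Lagrange.eval_interpolate_at_node f (Set.injOn_id _) hx
  have key : ∀ C : Matrix ι ι ℂ, IsSelfAdjoint C → spectrum ℝ C ⊆ S →
      cfc f C = Polynomial.aeval C p := by
    intro C hC hCS
    rw [← cfc_polynomial p C]
    exact cfc_congr fun x hx => (hpf x (by simpa using hCS hx)).symm
  rw [key A hA (by simp [hS]), key B hB (by simp [hS])]
  have hsemi : SemiconjBy K B A := h.symm
  clear_value p
  clear hp hpf key
  induction p using Polynomial.induction_on' with
  | add p q h1 h2 => simp [add_mul, mul_add, h1, h2]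
  | monomial n a =>
    have := (hsemi.pow_right n).eq
    simp [Polynomial.aeval_monomial, Algebra.algebraMap_eq_smul_one, this]

theorem Matrix.rpow_mul_eq_mul_rpow {A B K : Matrix ι ι ℂ} (hA : 0 ≤ A) (hB : 0 ≤ B)
    (h : A * K = K * B) (s : ℝ) : A ^ s * K = K * B ^ s := by
  rw [CFC.rpow_eq_cfc_real hA, CFC.rpow_eq_cfc_real hB]
  exact Matrix.cfc_mul_eq_mul_cfc hA.isSelfAdjoint hB.isSelfAdjoint h _

theorem Matrix.smul_rpow {A : Matrix ι ι ℂ} (hA : 0 ≤ A) {c : ℝ} (hc : 0 ≤ c) (s : ℝ) :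
    (c • A) ^ s = c ^ s • A ^ s := by
  have hfin := Matrix.finite_real_spectrum (A := A)
  rw [CFC.rpow_eq_cfc_real hA, CFC.rpow_eq_cfc_real (smul_nonneg hc hA),
    ← cfc_smul_id (R := ℝ) (S := ℝ) c A,
    ← cfc_comp' (fun x : ℝ => x ^ s) (fun x : ℝ => c • x) A
      (((hfin.image _).continuousOn _)),
    ← cfc_smul (R := ℝ) (c ^ s) (fun x : ℝ => x ^ s) A (hfin.continuousOn _)]
  refine cfc_congr fun x hx => ?_
  simp only [smul_eq_mul]
  exact Real.mul_rpow hc (spectrum_nonneg_of_nonneg hA hx)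


/-- The polar-type identity `K (Kᴴ K)^(z-1) Kᴴ = (K Kᴴ)^z` for invertible `K`. -/
theorem Matrix.mul_rpow_sub_one_mul_star {K : Matrix ι ι ℂ} (hK : IsUnit K) (z : ℝ) :
    K * (star K * K) ^ (z - 1) * star K = (K * star K) ^ z := by
  have h1 : IsStrictlyPositive (K * star K) :=
    (hK.mul hK.star).isStrictlyPositive (mul_star_self_nonneg K)
  have h2 : IsStrictlyPositive (star K * K) :=
    (hK.star.mul hK).isStrictlyPositive (star_mul_self_nonneg K)
  rw [← Matrix.rpow_mul_eq_mul_rpow h1.nonneg h2.nonneg (mul_assoc _ _ _) (z - 1), mul_assoc]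
  conv_lhs => rw [← CFC.rpow_one (K * star K) h1.nonneg]
  rw [CFC.rpow_rpow _ _ _ one_ne_zero, ← CFC.rpow_add h1.isUnit]
  congr 1
  ring

theorem Matrix.rpow_le_rpow_of_nonpos {A B : Matrix ι ι ℂ} (hA : IsStrictlyPositive A)
    (h : A ≤ B) {s : ℝ} (hs : s ∈ Set.Icc (-1) 0) : B ^ s ≤ A ^ s := by
  have hB := hA.of_le h
  rcases eq_or_ne s 0 with rfl | hs0
  · simp [CFC.rpow_zero A hA.nonneg, CFC.rpow_zero B hB.nonneg]
  have := CStarAlgebra.rpow_neg_one_le_rpow_neg_one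
    (CFC.rpow_le_rpow (p := -s) ⟨by linarith [hs.2], by linarith [hs.1]⟩ h) (hA.rpow _ _)
  rwa [CFC.rpow_rpow _ _ _ (neg_ne_zero.2 hs0), CFC.rpow_rpow _ _ _ (neg_ne_zero.2 hs0),
    mul_neg_one, neg_neg] at this

theorem Matrix.one_smul_rpow {c : ℝ} (hc : 0 ≤ c) (s : ℝ) :
    (c • (1 : Matrix ι ι ℂ)) ^ s = c ^ s • 1 := by
  rw [Matrix.smul_rpow (ι := ι) zero_le_one hc, CFC.one_rpow]

theorem Matrix.rpow_le_smul_one {A : Matrix ι ι ℂ} (hA : 0 ≤ A) {c s : ℝ}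
    (hs : 0 ≤ s) (h : A ≤ c • 1) : A ^ s ≤ c ^ s • 1 := by
  rw [← Algebra.algebraMap_eq_smul_one] at h ⊢
  rw [le_algebraMap_iff_spectrum_le hA.isSelfAdjoint] at h
  rw [CFC.rpow_eq_cfc_real hA]
  exact cfc_le_algebraMap _ _ _ (fun x hx =>
    Real.rpow_le_rpow (spectrum_nonneg_of_nonneg hA hx) (h x hx) hs)
    (Matrix.finite_real_spectrum.continuousOn _)

/-- The operator `R (R Y R)^(z-1) R`, which up to the factor `z` is the gradient of
`Y ↦ tr (R Y R)^z`. -/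
noncomputable def powGradient (z : ℝ) (R Y : Matrix ι ι ℂ) : Matrix ι ι ℂ :=
  R * (R * Y * R) ^ (z - 1) * R

/-- The polar-type identity with K = S R; conjugation trades the exponent z - 1 for z. -/
theorem conj_powGradient {R S : Matrix ι ι ℂ} (hR : IsStrictlyPositive R)
    (hS : IsStrictlyPositive S) (z : ℝ) :
    S * powGradient z R (S * S) * S = (S * (R * R) * S) ^ z := by
  have h := Matrix.mul_rpow_sub_one_mul_star (hS.isUnit.mul hR.isUnit) z
  simpa [powGradient, mul_assoc, hR.isSelfAdjoint.star_eq, hS.isSelfAdjoint.star_eq] using h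

theorem powGradient_nonneg {R : Matrix ι ι ℂ} (hR : IsStrictlyPositive R) (z : ℝ)
    (Y : Matrix ι ι ℂ) : 0 ≤ powGradient z R Y :=
  hR.isSelfAdjoint.conjugate_nonneg CFC.rpow_nonneg

theorem smul_rpow_le_powGradient {R Y : Matrix ι ι ℂ} (hR : IsStrictlyPositive R)
    (hY : IsStrictlyPositive Y) {z y : ℝ} (hz : z ∈ Set.Icc 0 1) (hy : 0 ≤ y) (h : Y ≤ y • 1) :
    y ^ (z - 1) • (R * R) ^ z ≤ powGradient z R Y := by
  have h1 : R * Y * R ≤ y • (R * R) := by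
    simpa using hR.isSelfAdjoint.conjugate_le_conjugate h
  have h2 : IsStrictlyPositive (R * Y * R) :=
    IsStrictlyPositive.conjugate_of_isUnit_of_isSelfAdjoint _ _ hR.isUnit hR.isSelfAdjoint hY
  have h3 := Matrix.rpow_le_rpow_of_nonpos h2 h1 (s := z - 1) ⟨by linarith [hz.1], by linarith [hz.2]⟩
  have hRR : 0 ≤ R * R := by simpa [hR.isSelfAdjoint.star_eq] using star_mul_self_nonneg R
  rw [Matrix.smul_rpow hRR hy] at h3
  have h4 := hR.isSelfAdjoint.conjugate_le_conjugate h3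
  have h5 := Matrix.mul_rpow_sub_one_mul_star hR.isUnit z
  rw [hR.isSelfAdjoint.star_eq] at h5
  simpa [powGradient, h5] using h4

theorem rpow_half_mul_self {Y : Matrix ι ι ℂ} (hY : 0 ≤ Y) :
    Y ^ (1 / 2 : ℝ) * Y ^ (1 / 2 : ℝ) = Y := by
  rw [← CFC.sqrt_eq_rpow, CFC.sqrt_mul_sqrt_self Y hY]

theorem rpow_conj_rpow {Y : Matrix ι ι ℂ} (hY : IsStrictlyPositive Y) (a b : ℝ) :
    Y ^ a * Y ^ b * Y ^ a = Y ^ (a + b + a) := by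
  rw [CFC.rpow_add hY.isUnit, CFC.rpow_add hY.isUnit]

/-- In this form R enters only through R² under the power z, so for z in [0, 1] scalar bounds on R²
transfer to the gradient. -/
theorem powGradient_eq_conj {R Y : Matrix ι ι ℂ} (hR : IsStrictlyPositive R)
    (hY : IsStrictlyPositive Y) (z : ℝ) :
    powGradient z R Y = Y ^ (-(1 / 2) : ℝ) *
      (Y ^ (1 / 2 : ℝ) * (R * R) * Y ^ (1 / 2 : ℝ)) ^ z * Y ^ (-(1 / 2) : ℝ) := by
  rw [← conj_powGradient hR (hY.rpow Y (1 / 2)) z, rpow_half_mul_self hY.nonneg]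
  have h1 := CFC.rpow_neg_mul_rpow (1 / 2) hY
  have h2 := CFC.rpow_mul_rpow_neg (1 / 2) hY
  rw [← mul_assoc, ← mul_assoc, h1, one_mul, mul_assoc, h2, mul_one]

theorem powGradient_le_smul_rpow {R Y : Matrix ι ι ℂ} (hR : IsStrictlyPositive R)
    (hY : IsStrictlyPositive Y) {z b : ℝ} (hz : z ∈ Set.Icc 0 1) (hb : 0 ≤ b)
    (h : R * R ≤ b • 1) : powGradient z R Y ≤ b ^ z • Y ^ (z - 1) := by
  have hS := hY.rpow Y (1 / 2)
  have h1 := CFC.rpow_le_rpow hz (hS.isSelfAdjoint.conjugate_le_conjugate h)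
  simp only [mul_smul_comm, mul_one, smul_mul_assoc, rpow_half_mul_self hY.nonneg,
    Matrix.smul_rpow hY.nonneg hb] at h1
  have h2 := (hY.rpow Y (-(1 / 2))).isSelfAdjoint.conjugate_le_conjugate h1
  rw [← powGradient_eq_conj hR hY] at h2
  refine h2.trans_eq ?_
  rw [mul_smul_comm, smul_mul_assoc, rpow_conj_rpow hY]
  congr 2
  ring

theorem smul_rpow_le_powGradient_of_le_sq {R Y : Matrix ι ι ℂ} (hR : IsStrictlyPositive R)
    (hY : IsStrictlyPositive Y) {z b : ℝ} (hz : z ∈ Set.Icc 0 1) (hb : 0 ≤ b)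
    (h : b • 1 ≤ R * R) : b ^ z • Y ^ (z - 1) ≤ powGradient z R Y := by
  have hS := hY.rpow Y (1 / 2)
  have h1 := CFC.rpow_le_rpow hz (hS.isSelfAdjoint.conjugate_le_conjugate h)
  simp only [mul_smul_comm, mul_one, smul_mul_assoc, rpow_half_mul_self hY.nonneg,
    Matrix.smul_rpow hY.nonneg hb] at h1
  have h2 := (hY.rpow Y (-(1 / 2))).isSelfAdjoint.conjugate_le_conjugate h1
  rw [← powGradient_eq_conj hR hY] at h2
  refine Eq.trans_le ?_ h2
  rw [mul_smul_comm, smul_mul_assoc, rpow_conj_rpow hY]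
  congr 2
  ring

end MatrixPowers

/-! ### Symmetry of the weighted geometric mean -/

/-- The geometric mean is symmetric: `P #ₛ A = A #₁₋ₛ P`. -/
theorem weightedGeometricMean_symm {m : ℕ} {A P : Matrix (Fin m) (Fin m) ℂ}
    (hA : IsStrictlyPositive A) (hP : IsStrictlyPositive P) (s : ℝ) :
    weightedGeometricMean s P A = weightedGeometricMean (1 - s) A P := by
  have hS := hP.rpow P (1 / 2)
  have hS' := hP.rpow P (-(1 / 2))
  have hR := hA.rpow A (1 / 2)
  have hR' := hA.rpow A (-(1 / 2))
  have hRR := rpow_half_mul_self hA.nonneg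
  have hSS := rpow_half_mul_self hP.nonneg
  have hS1 := CFC.rpow_neg_mul_rpow (1 / 2) hP
  have hS2 := CFC.rpow_mul_rpow_neg (1 / 2) hP
  have hR1 := CFC.rpow_neg_mul_rpow (1 / 2) hA
  have hR2 := CFC.rpow_mul_rpow_neg (1 / 2) hA
  unfold weightedGeometricMean
  generalize P ^ (1 / 2 : ℝ) = S at *
  generalize P ^ (-(1 / 2) : ℝ) = S' at *
  generalize A ^ (1 / 2 : ℝ) = R at *
  generalize A ^ (-(1 / 2) : ℝ) = R' at *
  subst hRR hSS
  -- The inner matrix is the inverse of K* K for K = R' S, so its power s is (K* K)^((1 - s) - 1),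
  -- as in the polar-type identity of order 1 - s.
  have hinv : S' * (R * R) * S' = (S * R' * (R' * S)) ^ (-1 : ℝ) := by
    have hpos : IsStrictlyPositive (S * R' * (R' * S)) := by
      have := (hS.isUnit.mul hR'.isUnit).isStrictlyPositive_star_right_conjugate_iff.2
        isStrictlyPositive_one
      simpa [hR'.isSelfAdjoint.star_eq, hS.isSelfAdjoint.star_eq] using this
    have h1 := CFC.rpow_mul_rpow_neg 1 hpos
    rw [CFC.rpow_one _ hpos.nonneg] at h1
    refine left_inv_eq_right_inv ?_ h1
    calc S' * (R * R) * S' * (S * R' * (R' * S))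
        = S' * R * (R * (S' * S) * R') * R' * S := by noncomm_ring
      _ = 1 := by rw [hS1, mul_one, hR2, mul_one, mul_assoc S', hR2, mul_one, hS1]
  have hpos : IsStrictlyPositive (S * R' * (R' * S)) := by
    have := (hS.isUnit.mul hR'.isUnit).isStrictlyPositive_star_right_conjugate_iff.2
      isStrictlyPositive_one
    simpa [hR'.isSelfAdjoint.star_eq, hS.isSelfAdjoint.star_eq] using this
  have h := Matrix.mul_rpow_sub_one_mul_star (hR'.isUnit.mul hS.isUnit) (1 - s)
  simp only [star_mul, hR'.isSelfAdjoint.star_eq, hS.isSelfAdjoint.star_eq] at h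
  rw [hinv, CFC.rpow_rpow _ _ _ (by norm_num), show R' * (S * S) * R' = R' * S * (S * R') by
    noncomm_ring, ← h, show -1 * s = 1 - s - 1 by ring]
  calc S * (S * R' * (R' * S)) ^ (1 - s - 1) * S
      = (R * R') * S * (S * R' * (R' * S)) ^ (1 - s - 1) * (S * (R' * R)) := by
        rw [hR2, hR1, one_mul, mul_one]
    _ = _ := by noncomm_ring

/-! ### Klein's inequality and tangent bounds for tr A^p -/

section TraceInequalities

variable {ι : Type*} [Fintype ι] [DecidableEq ι]

/-- The trace of a product of functions of two Hermitian matrices is a double sum over their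
eigenvalues, with nonnegative weights that do not depend on the functions. -/
theorem Matrix.exists_trace_cfc_mul_cfc {A B : Matrix ι ι ℂ} (hA : A.IsHermitian)
    (hB : B.IsHermitian) : ∃ p : ι → ι → ℝ, (∀ i j, 0 ≤ p i j) ∧ ∀ g h : ℝ → ℝ,
      (cfc g A * cfc h B).trace.re =
        ∑ i, ∑ j, p i j * (g (hA.eigenvalues i) * h (hB.eigenvalues j)) := by
  -- The weights are the squared moduli of the overlaps between the two eigenbases.
  set W : Matrix ι ι ℂ := star (hA.eigenvectorUnitary : Matrix ι ι ℂ) * hB.eigenvectorUnitary with hW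
  refine ⟨fun i j => ‖W i j‖ ^ 2, fun i j => by positivity, fun g h => ?_⟩
  rw [hA.cfc_eq, hB.cfc_eq, Matrix.IsHermitian.cfc, Matrix.IsHermitian.cfc,
    Unitary.conjStarAlgAut_apply, Unitary.conjStarAlgAut_apply, mul_assoc, mul_assoc,
    Matrix.trace_mul_comm]
  have : ∀ D₁ D₂ : Matrix ι ι ℂ, D₁ * (star (hA.eigenvectorUnitary : Matrix ι ι ℂ) *
      (hB.eigenvectorUnitary * D₂ * star (hB.eigenvectorUnitary : Matrix ι ι ℂ))) *
      hA.eigenvectorUnitary = D₁ * (W * D₂ * star W) := by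
    intro D₁ D₂
    simp only [hW, star_mul, star_star]
    noncomm_ring
  rw [this]
  simp only [Matrix.trace, Matrix.diag_apply, Complex.re_sum, Matrix.diagonal_mul,
    Matrix.mul_apply (M := W * _), Matrix.mul_diagonal, Matrix.star_apply, Finset.mul_sum]
  refine Finset.sum_congr rfl fun i _ => Finset.sum_congr rfl fun j _ => ?_
  have h1 : W i j * star (W i j) = ((‖W i j‖ ^ 2 : ℝ) : ℂ) := by
    rw [RCLike.star_def, RCLike.mul_conj]; push_cast; rfl
  have h2 : ∀ a b : ℝ, (a : ℂ) * (W i j * (b : ℂ) * star (W i j)) =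
      ((‖W i j‖ ^ 2 * (a * b) : ℝ) : ℂ) := by
    intro a b
    rw [show (a : ℂ) * (W i j * (b : ℂ) * star (W i j)) = W i j * star (W i j) * (a * b) by ring, h1]
    push_cast
    ring
  exact (congrArg Complex.re (h2 _ _)).trans (Complex.ofReal_re _)

/-- Klein's inequality. -/
theorem Matrix.klein_inequality {A B : Matrix ι ι ℂ} (hA : IsSelfAdjoint A) (hB : IsSelfAdjoint B)
    {f f' : ℝ → ℝ}
    (h : ∀ x ∈ spectrum ℝ A, ∀ y ∈ spectrum ℝ B, f y + f' y * (x - y) ≤ f x) :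
    (cfc f B).trace.re + (cfc f' B * (A - B)).trace.re ≤ (cfc f A).trace.re := by
  obtain ⟨p, hp, hpe⟩ := Matrix.exists_trace_cfc_mul_cfc hA.isHermitian hB.isHermitian
  -- Inserting the constant function 1 gives every trace the same weights, so the scalar hypothesis
  -- can be summed termwise.
  have h1 : (cfc f A).trace.re = (cfc f A * cfc (fun _ => (1 : ℝ)) B).trace.re := by
    rw [cfc_const_one ℝ B, mul_one]
  have h2 : (cfc f B).trace.re = (cfc (fun _ => (1 : ℝ)) A * cfc f B).trace.re := by
    rw [cfc_const_one ℝ A, one_mul]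
  have h3 : (cfc f' B * A).trace.re = (cfc (fun x : ℝ => x) A * cfc f' B).trace.re := by
    rw [cfc_id' ℝ A, Matrix.trace_mul_comm]
  have h4 : (cfc f' B * B).trace.re =
      (cfc (fun _ => (1 : ℝ)) A * cfc (fun y => f' y * y) B).trace.re := by
    rw [cfc_const_one ℝ A, one_mul, cfc_mul f' (fun y => y) B
      (Matrix.finite_real_spectrum.continuousOn _), cfc_id' ℝ B]
  rw [mul_sub, Matrix.trace_sub, Complex.sub_re, h1, h2, h3, h4, hpe, hpe, hpe, hpe,
    ← Finset.sum_sub_distrib, ← Finset.sum_add_distrib]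
  refine Finset.sum_le_sum fun i _ => ?_
  rw [← Finset.sum_sub_distrib, ← Finset.sum_add_distrib]
  refine Finset.sum_le_sum fun j _ => ?_
  have := mul_le_mul_of_nonneg_left (h _ (hA.isHermitian.eigenvalues_mem_spectrum_real i) _
    (hB.isHermitian.eigenvalues_mem_spectrum_real j)) (hp i j)
  linarith

/-- Bernoulli's inequality for x / y, scaled by y^p. -/
theorem Real.rpow_add_mul_sub_le_rpow {x y p : ℝ} (hx : 0 < x) (hy : 0 < y) (hp : 1 ≤ p) :
    y ^ p + p * y ^ (p - 1) * (x - y) ≤ x ^ p := by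
  have h := one_add_mul_self_le_rpow_one_add (s := x / y - 1) (by linarith [div_pos hx hy]) hp
  rw [add_sub_cancel, Real.div_rpow hx.le hy.le, le_div_iff₀ (Real.rpow_pos_of_pos hy p)] at h
  refine Eq.trans_le ?_ h
  rw [Real.rpow_sub_one hy.ne']
  field_simp

theorem Real.rpow_le_rpow_add_mul_sub {x y p : ℝ} (hx : 0 < x) (hy : 0 < y) (hp : 0 ≤ p)
    (hp1 : p ≤ 1) : x ^ p ≤ y ^ p + p * y ^ (p - 1) * (x - y) := by
  have h := rpow_one_add_le_one_add_mul_self (s := x / y - 1) (by linarith [div_pos hx hy]) hp hp1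
  rw [add_sub_cancel, Real.div_rpow hx.le hy.le, div_le_iff₀ (Real.rpow_pos_of_pos hy p)] at h
  refine h.trans_eq ?_
  rw [Real.rpow_sub_one hy.ne']
  field_simp

theorem Matrix.trace_rpow_add_le {A B : Matrix ι ι ℂ} (hA : IsStrictlyPositive A)
    (hB : IsStrictlyPositive B) {p : ℝ} (hp : 1 ≤ p) :
    (B ^ p).trace.re + p * (B ^ (p - 1) * (A - B)).trace.re ≤ (A ^ p).trace.re := by
  have h := Matrix.klein_inequality hA.isSelfAdjoint hB.isSelfAdjoint (f := fun x => x ^ p)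
    (f' := fun x => p * x ^ (p - 1)) fun x hx y hy =>
      Real.rpow_add_mul_sub_le_rpow (hA.spectrum_pos hx) (hB.spectrum_pos hy) hp
  rw [cfc_const_mul p (fun x : ℝ => x ^ (p - 1)) B (Matrix.finite_real_spectrum.continuousOn _),
    ← CFC.rpow_eq_cfc_real hA.nonneg, ← CFC.rpow_eq_cfc_real hB.nonneg,
    ← CFC.rpow_eq_cfc_real hB.nonneg, smul_mul_assoc, Matrix.trace_smul, Complex.smul_re] at h
  exact h

theorem Matrix.trace_rpow_le_add {A B : Matrix ι ι ℂ} (hA : IsStrictlyPositive A)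
    (hB : IsStrictlyPositive B) {p : ℝ} (hp : p ∈ Set.Icc 0 1) :
    (A ^ p).trace.re ≤ (B ^ p).trace.re + p * (B ^ (p - 1) * (A - B)).trace.re := by
  have h := Matrix.klein_inequality hA.isSelfAdjoint hB.isSelfAdjoint (f := fun x => -x ^ p)
    (f' := fun x => (-p) * x ^ (p - 1)) fun x hx y hy => by
      have := Real.rpow_le_rpow_add_mul_sub (hA.spectrum_pos hx) (hB.spectrum_pos hy) hp.1 hp.2
      linarith
  rw [cfc_const_mul (-p) (fun x : ℝ => x ^ (p - 1)) B
    (Matrix.finite_real_spectrum.continuousOn _), cfc_neg, cfc_neg,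
    ← CFC.rpow_eq_cfc_real hA.nonneg, ← CFC.rpow_eq_cfc_real hB.nonneg,
    ← CFC.rpow_eq_cfc_real hB.nonneg, smul_mul_assoc, Matrix.trace_smul, Complex.smul_re,
    Matrix.trace_neg, Matrix.trace_neg, Complex.neg_re, Complex.neg_re, smul_eq_mul] at h
  linarith

theorem Matrix.trace_mul_nonneg {A B : Matrix ι ι ℂ} (hA : 0 ≤ A) (hB : 0 ≤ B) :
    0 ≤ (A * B).trace.re := by
  have h : 0 ≤ A ^ (1 / 2 : ℝ) * B * A ^ (1 / 2 : ℝ) :=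
    (CFC.rpow_nonneg (a := A)).isSelfAdjoint.conjugate_nonneg hB
  have h1 := (Matrix.nonneg_iff_posSemidef.1 h).trace_nonneg
  rw [Matrix.trace_mul_comm, ← mul_assoc, rpow_half_mul_self hA] at h1
  exact (Complex.le_def.1 h1).1

theorem Matrix.trace_mul_le_trace_mul {A B C : Matrix ι ι ℂ} (hC : 0 ≤ C) (h : A ≤ B) :
    (A * C).trace.re ≤ (B * C).trace.re := by
  have := Matrix.trace_mul_nonneg (sub_nonneg.2 h) hC
  rw [sub_mul, Matrix.trace_sub, Complex.sub_re] at this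
  linarith

end TraceInequalities

theorem Matrix.eq_zero_of_trace_mul_self {ι : Type*} [Fintype ι] {A : Matrix ι ι ℂ}
    (hA : IsSelfAdjoint A) (h : (A * A).trace.re ≤ 0) : A = 0 := by
  have h0 := (Matrix.posSemidef_conjTranspose_mul_self A).trace_nonneg
  rw [← Matrix.trace_conjTranspose_mul_self_eq_zero_iff]
  have h1 : Matrix.conjTranspose A = A := hA
  rw [h1] at h0 ⊢
  obtain ⟨hr, hi⟩ := Complex.le_def.1 h0
  exact Complex.ext (le_antisymm h hr) hi.symm

/-! ### The convex objective: gradient inequality, stationarity, existence of a minimizer -/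

section RenyiObjective

variable {ι κ : Type*} [Fintype ι] [DecidableEq ι] [Fintype κ]

theorem Matrix.isCompact_Icc_smul_one (d c : ℝ) (hd : 0 ≤ d) :
    IsCompact {Y : Matrix ι ι ℂ | d • 1 ≤ Y ∧ Y ≤ c • 1} := by
  have : ProperSpace (Matrix ι ι ℂ) := FiniteDimensional.proper ℂ _
  refine Metric.isCompact_of_isClosed_isBounded (isClosed_Icc (a := d • (1 : Matrix ι ι ℂ))) ?_
  rw [Metric.isBounded_iff_subset_closedBall 0]
  refine ⟨‖c • (1 : Matrix ι ι ℂ)‖, fun Y hY => ?_⟩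
  have h0 : 0 ≤ Y := (smul_nonneg hd zero_le_one).trans hY.1
  simpa using CStarAlgebra.norm_le_norm_of_nonneg_of_le h0 hY.2

theorem Matrix.isStrictlyPositive_iff_exists_smul_one_le {A : Matrix ι ι ℂ}
    (hA : IsSelfAdjoint A) : IsStrictlyPositive A ↔ ∃ d : ℝ, 0 < d ∧ d • 1 ≤ A := by
  constructor
  · intro h
    rcases isEmpty_or_nonempty ι with hι | hι
    · exact ⟨1, one_pos, (Subsingleton.elim _ _).le⟩
    · simp only [← Algebra.algebraMap_eq_smul_one]
      exact (CFC.exists_pos_algebraMap_le_iff hA).2 fun x hx => h.spectrum_pos hx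
  · rintro ⟨d, hd, h⟩
    exact (IsStrictlyPositive.smul hd isStrictlyPositive_one).of_le h

/-- The `Y`-dependent part of the Rényi objective, in the variable `Y = X ^ (t / z)`. -/
noncomputable def renyiObjective (t z : ℝ) (w : κ → ℝ) (R : κ → Matrix ι ι ℂ)
    (Y : Matrix ι ι ℂ) : ℝ :=
  t * (Y ^ (z / t)).trace.re - ∑ j, w j * ((R j * Y * R j) ^ z).trace.re

/-- The gradient of the Rényi objective, divided by `z`. -/
noncomputable def renyiGradient (t z : ℝ) (w : κ → ℝ) (R : κ → Matrix ι ι ℂ)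
    (Y : Matrix ι ι ℂ) : Matrix ι ι ℂ :=
  Y ^ (z / t - 1) - ∑ j, w j • powGradient z (R j) Y

variable {t z : ℝ} {w : κ → ℝ} {R : κ → Matrix ι ι ℂ}

theorem renyiGradient_isSelfAdjoint (hR : ∀ j, IsStrictlyPositive (R j)) (Y : Matrix ι ι ℂ) :
    IsSelfAdjoint (renyiGradient t z w R Y) := by
  refine (CFC.rpow_nonneg (a := Y)).isSelfAdjoint.sub ?_
  refine isSelfAdjoint_sum _ fun j _ => ?_
  exact (IsSelfAdjoint.all (w j)).smul (powGradient_nonneg (hR j) z Y).isSelfAdjoint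

/-- Convexity as a tangent inequality, obtained from the trace bounds for the exponents z/t ≥ 1 and
z ≤ 1. It replaces differentiation of the objective throughout. -/
theorem renyiObjective_sub_le (ht : 0 < t) (htz : t ≤ z) (hz : z ≤ 1) (hw : ∀ j, 0 ≤ w j)
    (hR : ∀ j, IsStrictlyPositive (R j)) {Y Y' : Matrix ι ι ℂ} (hY : IsStrictlyPositive Y)
    (hY' : IsStrictlyPositive Y') :
    renyiObjective t z w R Y' - renyiObjective t z w R Y ≤
      z * (renyiGradient t z w R Y' * (Y' - Y)).trace.re := by
  have h1 := Matrix.trace_rpow_add_le hY hY' (p := z / t) ((one_le_div ht).2 htz)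
  have h2 : ∀ j, ((R j * Y * R j) ^ z).trace.re ≤ ((R j * Y' * R j) ^ z).trace.re +
      z * (powGradient z (R j) Y' * (Y - Y')).trace.re := by
    intro j
    have hc : ∀ {V : Matrix ι ι ℂ}, IsStrictlyPositive V → IsStrictlyPositive (R j * V * R j) :=
      fun hV => IsStrictlyPositive.conjugate_of_isUnit_of_isSelfAdjoint _ _ (hR j).isUnit
        (hR j).isSelfAdjoint hV
    have h := Matrix.trace_rpow_le_add (hc hY) (hc hY') (p := z) ⟨by linarith, hz⟩
    have e : (powGradient z (R j) Y' * (Y - Y')).trace =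
        ((R j * Y' * R j) ^ (z - 1) * (R j * Y * R j - R j * Y' * R j)).trace := by
      rw [powGradient, mul_assoc, mul_assoc, Matrix.trace_mul_comm]
      congr 1
      noncomm_ring
    rwa [e]
  have h3 := Finset.sum_le_sum fun j (_ : j ∈ Finset.univ) =>
    mul_le_mul_of_nonneg_left (h2 j) (hw j)
  have h4 : (renyiGradient t z w R Y' * (Y' - Y)).trace.re =
      -(Y' ^ (z / t - 1) * (Y - Y')).trace.re +
        ∑ j, w j * (powGradient z (R j) Y' * (Y - Y')).trace.re := by
    rw [renyiGradient, ← neg_sub Y Y', mul_neg, sub_mul, Finset.sum_mul, Matrix.trace_neg,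
      Matrix.trace_sub, Matrix.trace_sum]
    simp only [smul_mul_assoc, Matrix.trace_smul, Complex.neg_re, Complex.sub_re, Complex.re_sum,
      Complex.smul_re, smul_eq_mul]
    ring
  have h5 := mul_le_mul_of_nonneg_left h1 ht.le
  have h6 : t * (z / t) = z := by field_simp
  simp only [mul_add, Finset.sum_add_distrib] at h3
  simp only [mul_add, ← mul_assoc, h6] at h5
  simp only [mul_left_comm _ z, ← Finset.mul_sum] at h3
  rw [renyiObjective, renyiObjective, h4]
  linarith

theorem continuousOn_renyiGradient (hR : ∀ j, IsStrictlyPositive (R j)) :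
    ContinuousOn (renyiGradient t z w R) {Y | IsStrictlyPositive Y} := by
  refine (CFC.continuousOn_rpow _).sub (continuousOn_finsetSum _ fun j _ => ?_)
  suffices h : ContinuousOn (fun Y => (R j * Y * R j) ^ (z - 1)) {Y | IsStrictlyPositive Y} from
    ((continuousOn_const.mul h).mul continuousOn_const).const_smul (w j)
  refine (CFC.continuousOn_rpow (z - 1)).comp (t := {Y | IsStrictlyPositive Y}) (by fun_prop) ?_
  exact fun Y hY => IsStrictlyPositive.conjugate_of_isUnit_of_isSelfAdjoint _ _ (hR j).isUnit
        (hR j).isSelfAdjoint hY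

theorem continuousOn_renyiObjective (hR : ∀ j, IsStrictlyPositive (R j)) :
    ContinuousOn (renyiObjective t z w R) {Y | IsStrictlyPositive Y} := by
  have htr : Continuous fun Y : Matrix ι ι ℂ => Y.trace.re :=
    Complex.continuous_re.comp (continuous_id.matrix_trace)
  refine (continuousOn_const.mul (htr.comp_continuousOn (CFC.continuousOn_rpow _))).sub
    (continuousOn_finsetSum _ fun j _ => continuousOn_const.mul (htr.comp_continuousOn ?_))
  refine (CFC.continuousOn_rpow z).comp (t := {Y | IsStrictlyPositive Y}) (by fun_prop) ?_
  exact fun Y hY => IsStrictlyPositive.conjugate_of_isUnit_of_isSelfAdjoint _ _ (hR j).isUnit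
        (hR j).isSelfAdjoint hY

/-- The first order condition at a minimizer. -/
theorem renyiGradient_eq_zero_of_isMinOn (ht : 0 < t) (htz : t ≤ z) (hz : z ≤ 1)
    (hw : ∀ j, 0 ≤ w j) (hR : ∀ j, IsStrictlyPositive (R j)) {Y : Matrix ι ι ℂ}
    (hY : IsStrictlyPositive Y)
    (hmin : IsMinOn (renyiObjective t z w R) {Y | IsStrictlyPositive Y} Y) :
    renyiGradient t z w R Y = 0 := by
  -- Perturb along the negative gradient. The tangent inequality at Y + εH together with minimality
  -- gives tr(∇(Y + εH) H) ≥ 0; letting ε → 0 gives -tr(∇(Y)²) ≥ 0.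
  set H := -renyiGradient t z w R Y with hH
  have hHsa : IsSelfAdjoint H := (renyiGradient_isSelfAdjoint hR Y).neg
  obtain ⟨d, hd, hdY⟩ := (Matrix.isStrictlyPositive_iff_exists_smul_one_le hY.isSelfAdjoint).1 hY
  have hpos : ∀ᶠ ε : ℝ in nhdsWithin 0 (Set.Ioi 0), IsStrictlyPositive (Y + ε • H) := by
    have h1 : ∀ᶠ ε : ℝ in nhdsWithin 0 (Set.Ioi 0), ε * ‖H‖ < d := by
      have : Filter.Tendsto (fun ε : ℝ => ε * ‖H‖) (nhdsWithin 0 (Set.Ioi 0)) (nhds (0 * ‖H‖)) :=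
        ((continuous_id.mul continuous_const).tendsto 0).mono_left nhdsWithin_le_nhds
      exact this.eventually_lt_const (by simpa using hd)
    filter_upwards [h1, self_mem_nhdsWithin] with ε hε hε0
    have hε0' : (0 : ℝ) ≤ ε := le_of_lt hε0
    refine (Matrix.isStrictlyPositive_iff_exists_smul_one_le
      (hY.isSelfAdjoint.add ((IsSelfAdjoint.all ε).smul hHsa))).2
      ⟨d - ε * ‖H‖, by linarith, ?_⟩
    have h2 := hHsa.neg_algebraMap_norm_le_self
    rw [Algebra.algebraMap_eq_smul_one] at h2
    have h3 := add_le_add hdY (smul_le_smul_of_nonneg_left h2 hε0')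
    refine Eq.trans_le ?_ h3
    rw [sub_smul, smul_neg, smul_smul, sub_eq_add_neg]
  have hcont : Filter.Tendsto (fun ε : ℝ => (renyiGradient t z w R (Y + ε • H) * H).trace.re)
      (nhdsWithin 0 (Set.Ioi 0)) (nhds (renyiGradient t z w R Y * H).trace.re) := by
    have htr : Continuous fun V : Matrix ι ι ℂ => (V * H).trace.re :=
      Complex.continuous_re.comp ((continuous_id.mul continuous_const).matrix_trace)
    refine (htr.tendsto _).comp ?_
    refine (continuousOn_renyiGradient hR Y hY).tendsto.comp
      (tendsto_nhdsWithin_iff.2 ⟨?_, hpos⟩)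
    have : Continuous fun ε : ℝ => Y + ε • H := by fun_prop
    simpa using (this.tendsto 0).mono_left nhdsWithin_le_nhds
  have hnn : 0 ≤ (renyiGradient t z w R Y * H).trace.re := by
    refine ge_of_tendsto hcont ?_
    filter_upwards [hpos, self_mem_nhdsWithin] with ε hε hε0
    have h1 := renyiObjective_sub_le ht htz hz hw hR hY hε
    have h2 : renyiObjective t z w R Y ≤ renyiObjective t z w R (Y + ε • H) := hmin hε
    rw [add_sub_cancel_left, mul_smul_comm, Matrix.trace_smul, Complex.smul_re, smul_eq_mul] at h1
    have hzε : 0 < z * ε := mul_pos (by linarith) hε0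
    refine nonneg_of_mul_nonneg_right (a := z * ε) ?_ hzε
    linarith
  refine Matrix.eq_zero_of_trace_mul_self (renyiGradient_isSelfAdjoint hR Y) ?_
  rw [hH, mul_neg, Matrix.trace_neg, Complex.neg_re] at hnn
  linarith


/-- Truncating the spectrum of `Y` to a suitable interval does not increase the objective. -/
theorem renyiObjective_clamp_le (ht : 0 < t) (htz : t ≤ z) (hz : z < 1) (hw : ∀ j, 0 ≤ w j)
    (hw1 : ∑ j, w j = 1) (hR : ∀ j, IsStrictlyPositive (R j)) {d c : ℝ} (hd : 0 < d)
    (hdc : d ≤ c) (hdR : ∀ j, d ^ ((z / t - z) / z) • 1 ≤ R j * R j)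
    (hcR : ∀ j, R j * R j ≤ c ^ ((z / t - z) / z) • 1)
    {Y : Matrix ι ι ℂ} (hY : IsStrictlyPositive Y) :
    renyiObjective t z w R (cfc (fun x : ℝ => max d (min x c)) Y) ≤ renyiObjective t z w R Y := by
  set k : ℝ → ℝ := fun x => max d (min x c) with hk
  have hz0 : 0 < z := ht.trans_le htz
  have hkpos : ∀ x, 0 < k x := fun x => hd.trans_le (le_max_left _ _)
  have hcont : ∀ f : ℝ → ℝ, ContinuousOn f (spectrum ℝ Y) := fun f =>
    Matrix.finite_real_spectrum.continuousOn f
  set Y' := cfc k Y with hY'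
  have hY'pos : IsStrictlyPositive Y' := by
    refine (Matrix.isStrictlyPositive_iff_exists_smul_one_le (cfc_predicate k Y)).2 ⟨d, hd, ?_⟩
    rw [← Algebra.algebraMap_eq_smul_one]
    exact algebraMap_le_cfc k d Y (fun x _ => le_max_left _ _) (hcont k)
  have hpow : ∀ s : ℝ, Y' ^ s = cfc (fun x => k x ^ s) Y := fun s =>
    CFC.cfc_rpow (fun x _ => hkpos x) (hcont k) hY.isSelfAdjoint
  -- Y' - Y = F - F', where F lives on the spectral subspace on which Y' equals d, and F' on the one
  -- on which Y' equals c.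
  set F : Matrix ι ι ℂ := cfc (fun x => max (d - x) 0) Y with hF
  set F' : Matrix ι ι ℂ := cfc (fun x => max (x - c) 0) Y with hF'
  have hF0 : 0 ≤ F := cfc_nonneg fun x _ => le_max_right _ _
  have hF'0 : 0 ≤ F' := cfc_nonneg fun x _ => le_max_right _ _
  have hdiff : Y' - Y = F - F' := by
    conv_lhs => enter [2]; rw [← cfc_id' ℝ Y]
    rw [hF, hF', ← cfc_sub _ _ Y (hcont _) (hcont _), ← cfc_sub _ _ Y (hcont _) (hcont _)]
    refine cfc_congr fun x _ => ?_
    simp only [hk]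
    rcases le_total x c with h | h
    · rw [min_eq_left h, max_eq_right (b := (0 : ℝ)) (a := x - c) (by linarith)]
      rcases le_total d x with h' | h'
      · rw [max_eq_right h', max_eq_right (by linarith)]; ring
      · rw [max_eq_left h', max_eq_left (by linarith)]; ring
    · rw [min_eq_right h, max_eq_right hdc, max_eq_left (a := x - c) (by linarith),
        max_eq_right (a := d - x) (by linarith)]
      ring
  -- The exponent (z/t - z)/z is chosen so that the two gradient bounds below vanish where Y' equals
  -- the respective threshold.
  have hS : ∀ e : ℝ, 0 < e → (e ^ ((z / t - z) / z)) ^ z * e ^ (z - 1) = e ^ (z / t - 1) := by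
    intro e he
    rw [← Real.rpow_mul he.le, ← Real.rpow_add he]
    congr 1
    field_simp
    ring
  have hvanish : ∀ (e : ℝ) (f : ℝ → ℝ), 0 < e → (∀ x, f x ≠ 0 → k x = e) →
      (Y' ^ (z / t - 1) - (e ^ ((z / t - z) / z)) ^ z • Y' ^ (z - 1)) * cfc f Y = 0 := by
    intro e f he hf
    rw [hpow, hpow, ← cfc_smul (R := ℝ) _ _ Y (hcont _), ← cfc_sub _ _ Y (hcont _) (hcont _),
      ← cfc_mul _ _ Y (hcont _) (hcont _), ← cfc_zero ℝ Y]
    refine cfc_congr fun x _ => ?_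
    simp only [smul_eq_mul, Pi.zero_apply]
    by_cases hfx : f x = 0
    · rw [hfx, mul_zero]
    · rw [hf x hfx, hS e he, sub_self, zero_mul]
  have hzI : z ∈ Set.Icc (0 : ℝ) 1 := ⟨hz0.le, hz.le⟩
  have hlow : renyiGradient t z w R Y' ≤
      Y' ^ (z / t - 1) - (d ^ ((z / t - z) / z)) ^ z • Y' ^ (z - 1) := by
    refine sub_le_sub_left ?_ _
    calc _ = ∑ j, w j • ((d ^ ((z / t - z) / z)) ^ z • Y' ^ (z - 1)) := by
          rw [← Finset.sum_smul, hw1, one_smul]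
      _ ≤ _ := Finset.sum_le_sum fun j _ => smul_le_smul_of_nonneg_left
          (smul_rpow_le_powGradient_of_le_sq (hR j) hY'pos hzI (by positivity) (hdR j)) (hw j)
  have hupp : Y' ^ (z / t - 1) - (c ^ ((z / t - z) / z)) ^ z • Y' ^ (z - 1) ≤
      renyiGradient t z w R Y' := by
    refine sub_le_sub_left ?_ _
    calc _ ≤ ∑ j, w j • ((c ^ ((z / t - z) / z)) ^ z • Y' ^ (z - 1)) :=
          Finset.sum_le_sum fun j _ => smul_le_smul_of_nonneg_left
          (powGradient_le_smul_rpow (hR j) hY'pos hzI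
            (Real.rpow_nonneg (hd.le.trans hdc) _) (hcR j)) (hw j)
      _ = _ := by rw [← Finset.sum_smul, hw1, one_smul]
  -- These give tr(∇F) ≤ 0 ≤ tr(∇F') with ∇ taken at Y', so the tangent inequality has a nonpositive
  -- right-hand side.
  have h1 := Matrix.trace_mul_le_trace_mul hF0 hlow
  have h2 := Matrix.trace_mul_le_trace_mul hF'0 hupp
  rw [hF, hvanish d _ hd] at h1
  · rw [hF', hvanish c _ (hd.trans_le hdc)] at h2
    · have h3 := renyiObjective_sub_le ht htz hz.le hw hR hY hY'pos
      rw [hdiff, mul_sub, Matrix.trace_sub, Complex.sub_re] at h3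
      simp only [Matrix.trace_zero, Complex.zero_re] at h1 h2
      have := mul_nonneg hz0.le (sub_nonneg.2 (h1.trans h2))
      linarith
    · intro x hx
      have : c < x := by
        by_contra hcx
        exact hx (max_eq_right (by linarith))
      simp only [hk]
      rw [min_eq_right this.le, max_eq_right hdc]
  · intro x hx
    have : x < d := by
      by_contra hcx
      exact hx (max_eq_right (by linarith))
    simp only [hk]
    rw [min_eq_left (this.le.trans hdc), max_eq_left this.le]

theorem exists_isMinOn_renyiObjective (ht : 0 < t) (htz : t ≤ z) (hz : z < 1)
    (hw : ∀ j, 0 ≤ w j) (hw1 : ∑ j, w j = 1) (hR : ∀ j, IsStrictlyPositive (R j)) :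
    ∃ Y : Matrix ι ι ℂ, IsStrictlyPositive Y ∧
      IsMinOn (renyiObjective t z w R) {Y | IsStrictlyPositive Y} Y := by
  have hz0 : 0 < z := ht.trans_le htz
  have hRR : ∀ j, IsStrictlyPositive (R j * R j) := fun j => by
    have := IsStrictlyPositive.conjugate_of_isUnit_of_isSelfAdjoint (1 : Matrix ι ι ℂ) (R j)
      (hR j).isUnit (hR j).isSelfAdjoint isStrictlyPositive_one
    rwa [mul_one] at this
  choose b hb hbR using fun j =>
    (Matrix.isStrictlyPositive_iff_exists_smul_one_le (hRR j).isSelfAdjoint).1 (hRR j)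
  obtain ⟨b₀, hb₀, hb₀'⟩ : ∃ b₀ : ℝ, 0 < b₀ ∧ ∀ j, b₀ ≤ b j := by
    have h1 : ∀ᶠ x : ℝ in nhdsWithin 0 (Set.Ioi 0), ∀ j, x ≤ b j :=
      Filter.eventually_all.2 fun j => nhdsWithin_le_nhds (eventually_le_nhds (hb j))
    obtain ⟨x, hx, hx'⟩ := (h1.and self_mem_nhdsWithin).exists
    exact ⟨x, hx', hx⟩
  -- β dominates every R_j², and the summand b₀ ensures b₀ ≤ β, hence d ≤ c.
  set β : ℝ := b₀ + ∑ j, ‖R j * R j‖ with hβ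
  set q : ℝ := (z / t - z) / z with hq
  have hq0 : 0 < q := by
    have : z < z / t := by
      rw [lt_div_iff₀ ht]
      nlinarith
    exact div_pos (by linarith) hz0
  have hsum : 0 ≤ ∑ j, ‖R j * R j‖ := Finset.sum_nonneg fun j _ => norm_nonneg _
  have hβ0 : 0 < β := by linarith
  have hinv : ∀ x : ℝ, 0 < x → (x ^ q⁻¹) ^ q = x := fun x hx => Real.rpow_inv_rpow hx.le hq0.ne'
  set d : ℝ := b₀ ^ q⁻¹ with hd
  set c : ℝ := β ^ q⁻¹ with hc
  have hd0 : 0 < d := Real.rpow_pos_of_pos hb₀ _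
  have hdc : d ≤ c := Real.rpow_le_rpow hb₀.le (by linarith) (inv_nonneg.2 hq0.le)
  have hdR : ∀ j, d ^ q • 1 ≤ R j * R j := fun j => by
    rw [hd, hinv _ hb₀]
    exact (smul_le_smul_of_nonneg_right (hb₀' j) zero_le_one).trans (hbR j)
  have hcR : ∀ j, R j * R j ≤ c ^ q • 1 := fun j => by
    rw [hc, hinv _ hβ0]
    have h1 := (hRR j).isSelfAdjoint.le_algebraMap_norm_self
    rw [Algebra.algebraMap_eq_smul_one] at h1
    refine h1.trans (smul_le_smul_of_nonneg_right ?_ zero_le_one)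
    have := Finset.single_le_sum (f := fun j => ‖R j * R j‖) (fun j _ => norm_nonneg _)
      (Finset.mem_univ j)
    linarith
  have hsub : {Y : Matrix ι ι ℂ | d • 1 ≤ Y ∧ Y ≤ c • 1} ⊆ {Y | IsStrictlyPositive Y} :=
    fun Y hY => (IsStrictlyPositive.smul hd0 isStrictlyPositive_one).of_le hY.1
  obtain ⟨Y, hYK, hYmin⟩ := (Matrix.isCompact_Icc_smul_one (ι := ι) d c hd0.le).exists_isMinOn
    ⟨d • 1, le_rfl, smul_le_smul_of_nonneg_right hdc zero_le_one⟩
    ((continuousOn_renyiObjective (t := t) (z := z) (w := w) hR).mono hsub)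
  refine ⟨Y, hsub hYK, fun V hV => ?_⟩
  refine le_trans (hYmin ⟨?_, ?_⟩)
    (renyiObjective_clamp_le ht htz hz hw hw1 hR hd0 hdc hdR hcR hV)
  · rw [← Algebra.algebraMap_eq_smul_one]
    exact algebraMap_le_cfc _ d V (fun x _ => le_max_left _ _)
      (Matrix.finite_real_spectrum.continuousOn _) (IsStrictlyPositive.isSelfAdjoint hV)
  · rw [← Algebra.algebraMap_eq_smul_one]
    exact cfc_le_algebraMap _ c V (fun x _ => max_le hdc (min_le_right _ _))
      (Matrix.finite_real_spectrum.continuousOn _) (IsStrictlyPositive.isSelfAdjoint hV)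

end RenyiObjective

/-! ### Existence and norm bound for the power mean -/

section PowerMean

variable {m n : ℕ} {s : ℝ} {w : Fin n → ℝ} {A : Fin n → Matrix (Fin m) (Fin m) ℂ}

/-- By symmetry P can be made to occur only once, inside the operator monotone power 1 - s. -/
theorem weightedGeometricMean_mono {A P P' : Matrix (Fin m) (Fin m) ℂ}
    (hA : IsStrictlyPositive A) (hP : IsStrictlyPositive P) (hs : s ∈ Set.Icc 0 1) (h : P ≤ P') :
    weightedGeometricMean s P A ≤ weightedGeometricMean s P' A := by
  rw [weightedGeometricMean_symm hA hP, weightedGeometricMean_symm hA (hP.of_le h)]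
  exact (hA.rpow A (1 / 2)).isSelfAdjoint.conjugate_le_conjugate
    (CFC.rpow_le_rpow ⟨by linarith [hs.2], by linarith [hs.1]⟩
      ((hA.rpow A (-(1 / 2))).isSelfAdjoint.conjugate_le_conjugate h))

theorem weightedGeometricMean_smul_one {A : Matrix (Fin m) (Fin m) ℂ} {c : ℝ} (hc : 0 < c)
    (hA : 0 ≤ A) : weightedGeometricMean s (c • 1) A = c ^ (1 - s) • A ^ s := by
  rw [weightedGeometricMean, Matrix.one_smul_rpow hc.le, Matrix.one_smul_rpow hc.le]
  simp only [smul_mul_assoc, one_mul, mul_smul_comm, mul_one, smul_smul]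
  rw [Matrix.smul_rpow hA (by positivity), smul_smul, ← Real.rpow_add hc, ← Real.rpow_add hc,
    ← Real.rpow_mul hc.le, ← Real.rpow_add hc]
  congr 2
  ring

theorem continuousOn_weightedGeometricMean {A : Matrix (Fin m) (Fin m) ℂ}
    (hA : IsStrictlyPositive A) (s : ℝ) :
    ContinuousOn (fun P => weightedGeometricMean s P A) {P | IsStrictlyPositive P} := by
  have h : ContinuousOn (fun P => (A ^ (-(1 / 2) : ℝ) * P * A ^ (-(1 / 2) : ℝ)) ^ (1 - s))
      {P | IsStrictlyPositive P} := by
    refine (CFC.continuousOn_rpow (1 - s)).comp (t := {Y | IsStrictlyPositive Y}) (by fun_prop) ?_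
    have hR := hA.rpow A (-(1 / 2))
    exact fun Y hY => IsStrictlyPositive.conjugate_of_isUnit_of_isSelfAdjoint _ _ hR.isUnit
      hR.isSelfAdjoint hY
  exact ((continuousOn_const.mul h).mul continuousOn_const).congr fun P hP =>
    weightedGeometricMean_symm hA hP s

/-- A monotone continuous self-map of positive definite matrices that maps an order interval
`[d • 1, c • 1]` into itself has a fixed point in it. -/
theorem Matrix.exists_fixedPoint_of_monotone {ι : Type*} [Fintype ι] [DecidableEq ι]
    {f : Matrix ι ι ℂ → Matrix ι ι ℂ} {d c : ℝ} (hd : 0 < d) (hdc : d ≤ c)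
    (hcont : ContinuousOn f {P | IsStrictlyPositive P})
    (hmono : ∀ P P', IsStrictlyPositive P → P ≤ P' → f P ≤ f P')
    (hlow : d • 1 ≤ f (d • 1)) (hupp : f (c • 1) ≤ c • 1) :
    ∃ P, IsStrictlyPositive P ∧ f P = P := by
  set K : Set (Matrix ι ι ℂ) := {P | d • 1 ≤ P ∧ P ≤ c • 1} with hK
  have hd1 : IsStrictlyPositive (d • (1 : Matrix ι ι ℂ)) :=
    IsStrictlyPositive.smul hd isStrictlyPositive_one
  have hsub : K ⊆ {P | IsStrictlyPositive P} := fun P hP => hd1.of_le hP.1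
  have hKc : IsCompact K := Matrix.isCompact_Icc_smul_one d c hd.le
  have hcontK := hcont.mono hsub
  -- Take P of least trace among the points of K with f P ≤ P. Then f P is again such a point, so P
  -- - f P is positive semidefinite of trace zero.
  have hLc : IsCompact (K ∩ (f - id) ⁻¹' Set.Iic 0) :=
    hKc.of_isClosed_subset ((hcontK.sub continuousOn_id).preimage_isClosed_of_isClosed
      hKc.isClosed isClosed_Iic) Set.inter_subset_left
  have htr : Continuous fun P : Matrix ι ι ℂ => P.trace.re :=
    Complex.continuous_re.comp (continuous_id.matrix_trace)
  obtain ⟨P, ⟨hPK, hPf⟩, hPmin⟩ := hLc.exists_isMinOn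
    ⟨c • 1, ⟨smul_le_smul_of_nonneg_right hdc zero_le_one, le_rfl⟩, sub_nonpos.2 hupp⟩
    htr.continuousOn
  have hfP : f P ≤ P := sub_nonpos.1 hPf
  have hdf : d • 1 ≤ f P := hlow.trans (hmono _ _ hd1 hPK.1)
  have hmem : f P ∈ K ∩ (f - id) ⁻¹' Set.Iic 0 :=
    ⟨⟨hdf, hfP.trans hPK.2⟩, sub_nonpos.2 (hmono _ _ (hd1.of_le hdf) hfP)⟩
  have h1 : P.trace.re ≤ (f P).trace.re := hPmin hmem
  have hpsd := Matrix.nonneg_iff_posSemidef.1 (sub_nonneg.2 hfP)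
  have h2 : (P - f P).trace = 0 := by
    obtain ⟨hr, hi⟩ := Complex.le_def.1 hpsd.trace_nonneg
    refine Complex.ext (le_antisymm ?_ hr) hi.symm
    rw [Matrix.trace_sub, Complex.sub_re, Complex.zero_re]
    linarith
  exact ⟨P, hsub hPK, (sub_eq_zero.1 (hpsd.trace_eq_zero_iff.1 h2)).symm⟩

theorem isStrictlyPositive_sum_smul {ι κ : Type*} [Fintype ι] [DecidableEq ι] [Fintype κ]
    {w : κ → ℝ} (hw : ∀ j, 0 ≤ w j) (hw1 : ∑ j, w j = 1) {B : κ → Matrix ι ι ℂ}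
    (hB : ∀ j, IsStrictlyPositive (B j)) : IsStrictlyPositive (∑ j, w j • B j) := by
  obtain ⟨i, -, hi⟩ : ∃ i ∈ Finset.univ, w i ≠ 0 :=
    Finset.exists_ne_zero_of_sum_ne_zero (by rw [hw1]; exact one_ne_zero)
  refine (IsStrictlyPositive.smul (lt_of_le_of_ne (hw i) hi.symm) (hB i)).of_le ?_
  exact Finset.single_le_sum (f := fun j => w j • B j)
    (fun j _ => smul_nonneg (hw j) (hB j).nonneg) (Finset.mem_univ i)

/-- On a scalar matrix c • 1 the fixed-point map equals c^(1-s) M. Since δ ≤ M ≤ δ + ‖M‖, the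
scalars δ^(1/s) and (δ + ‖M‖)^(1/s) bound an invariant order interval. -/
theorem exists_isPowerMean (hs : s ∈ Set.Ioo 0 1) (hw : ∀ j, 0 ≤ w j) (hw1 : ∑ j, w j = 1)
    (hA : ∀ j, IsStrictlyPositive (A j)) : ∃ X, IsPowerMean s w A X := by
  have hM := isStrictlyPositive_sum_smul hw hw1 fun j => (hA j).rpow (A j) s
  set M := ∑ j, w j • A j ^ s with hMdef
  obtain ⟨δ, hδ, hδM⟩ := (Matrix.isStrictlyPositive_iff_exists_smul_one_le hM.isSelfAdjoint).1 hM
  have hs0 : 0 < s := hs.1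
  have hf : ∀ x : ℝ, 0 < x → ∑ j, w j • weightedGeometricMean s (x ^ s⁻¹ • 1) (A j) =
      (x ^ s⁻¹ * x⁻¹) • M := by
    intro x hx
    have e : (x ^ s⁻¹) ^ (1 - s) = x ^ s⁻¹ * x⁻¹ := by
      rw [Real.rpow_sub (by positivity), Real.rpow_one, Real.rpow_inv_rpow hx.le hs0.ne',
        div_eq_mul_inv]
    rw [hMdef, Finset.smul_sum]
    refine Finset.sum_congr rfl fun j _ => ?_
    rw [weightedGeometricMean_smul_one (by positivity) (hA j).nonneg, e, smul_comm]
  have hscale : ∀ x : ℝ, 0 < x → (x ^ s⁻¹ * x⁻¹) * x = x ^ s⁻¹ := fun x hx => by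
    rw [mul_assoc, inv_mul_cancel₀ hx.ne', mul_one]
  have hμ : 0 < δ + ‖M‖ := by positivity
  obtain ⟨P, hP, hPf⟩ := Matrix.exists_fixedPoint_of_monotone
    (f := fun P => ∑ j, w j • weightedGeometricMean s P (A j))
    (d := δ ^ s⁻¹) (c := (δ + ‖M‖) ^ s⁻¹) (by positivity)
    (Real.rpow_le_rpow hδ.le (by linarith [norm_nonneg M]) (inv_nonneg.2 hs0.le))
    (continuousOn_finsetSum _ fun j _ =>
      (continuousOn_weightedGeometricMean (hA j) s).const_smul (w j))
    (fun P P' hP h => Finset.sum_le_sum fun j _ => smul_le_smul_of_nonneg_left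
      (weightedGeometricMean_mono (hA j) hP ⟨hs.1.le, hs.2.le⟩ h) (hw j))
    (by
      simp only [hf δ hδ]
      refine Eq.trans_le ?_ (smul_le_smul_of_nonneg_left hδM
        (show 0 ≤ δ ^ s⁻¹ * δ⁻¹ by positivity))
      rw [smul_smul, hscale δ hδ])
    (by
      simp only [hf _ hμ]
      have h1 : M ≤ (δ + ‖M‖) • 1 := by
        have h := hM.isSelfAdjoint.le_algebraMap_norm_self
        rw [Algebra.algebraMap_eq_smul_one] at h
        exact h.trans (smul_le_smul_of_nonneg_right (by linarith) zero_le_one)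
      refine (smul_le_smul_of_nonneg_left h1
        (show 0 ≤ (δ + ‖M‖) ^ s⁻¹ * (δ + ‖M‖)⁻¹ by positivity)).trans_eq ?_
      rw [smul_smul, hscale _ hμ])
  exact ⟨P, Matrix.isStrictlyPositive_iff_posDef.1 hP, hPf.symm⟩

/-- A power mean is bounded by `c` as soon as `∑ⱼ wⱼ Aⱼ ^ s ≤ c ^ s`. -/
theorem IsPowerMean.norm_le {X : Matrix (Fin m) (Fin m) ℂ} (hX : IsPowerMean s w A X)
    (hs : s ∈ Set.Ioo 0 1) (hw : ∀ j, 0 ≤ w j) (hA : ∀ j, IsStrictlyPositive (A j)) {c : ℝ}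
    (hc : 0 ≤ c) (h : ∑ j, w j • A j ^ s ≤ c ^ s • 1) : ‖X‖ ≤ c := by
  obtain ⟨hXpos, hXeq⟩ := hX
  have hX := Matrix.isStrictlyPositive_iff_posDef.2 hXpos
  rcases (norm_nonneg X).eq_or_lt with h0 | h0
  · rwa [← h0]
  have h1 : X ≤ ‖X‖ • 1 := by
    simpa only [Algebra.algebraMap_eq_smul_one] using hX.isSelfAdjoint.le_algebraMap_norm_self
  -- Replacing X by ‖X‖ • 1 inside the monotone fixed-point map; dividing by ‖X‖^(1-s) then leaves
  -- ‖X‖^s ≤ c^s.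
  have h2 : X ≤ (‖X‖ ^ (1 - s) * c ^ s) • 1 := by
    calc X = ∑ j, w j • weightedGeometricMean s X (A j) := hXeq
      _ ≤ ∑ j, w j • weightedGeometricMean s (‖X‖ • 1) (A j) :=
          Finset.sum_le_sum fun j _ => smul_le_smul_of_nonneg_left
            (weightedGeometricMean_mono (hA j) hX ⟨hs.1.le, hs.2.le⟩ h1) (hw j)
      _ = ‖X‖ ^ (1 - s) • ∑ j, w j • A j ^ s := by
          rw [Finset.smul_sum]
          refine Finset.sum_congr rfl fun j _ => ?_
          rw [weightedGeometricMean_smul_one h0 (hA j).nonneg, smul_comm]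
      _ ≤ ‖X‖ ^ (1 - s) • c ^ s • 1 := smul_le_smul_of_nonneg_left h (by positivity)
      _ = _ := by rw [smul_smul]
  have h3 : ‖X‖ ≤ ‖X‖ ^ (1 - s) * c ^ s := by
    rw [CStarAlgebra.norm_le_iff_le_algebraMap X (by positivity) hX.nonneg,
      Algebra.algebraMap_eq_smul_one]
    exact h2
  rw [Real.rpow_sub h0, Real.rpow_one, div_mul_eq_mul_div, le_div_iff₀ (by positivity)] at h3
  exact (Real.rpow_le_rpow_iff h0.le hc hs.1).1 (le_of_mul_le_mul_left h3 h0)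

end PowerMean

/-! ### The stationarity equation and the norm bounds -/

section RenyiRightMean

variable {m n : ℕ} {t z : ℝ} {w : Fin n → ℝ} {A : Fin n → Matrix (Fin m) (Fin m) ℂ}
  {X : Matrix (Fin m) (Fin m) ℂ}

theorem sum_buresWassersteinDivergence_eq (ht : 0 < t) (hz : 0 < z) (hw1 : ∑ j, w j = 1)
    (hX : IsStrictlyPositive X) :
    ∑ j, w j * buresWassersteinDivergence t z (A j) X =
      (∑ j, w j * ((1 - t) * (A j).trace.re)) +
        renyiObjective t z w (fun j => A j ^ ((1 - t) / (2 * z))) (X ^ (t / z)) := by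
  have h1 : (X ^ (t / z)) ^ (z / t) = X := by
    rw [CFC.rpow_rpow X _ _ (by positivity), div_mul_div_cancel₀ hz.ne', div_self ht.ne',
      CFC.rpow_one X hX.nonneg]
  simp only [buresWassersteinDivergence, renyiEntropy, renyiObjective, h1, Matrix.trace_add,
    Matrix.trace_smul, Complex.add_re, Complex.smul_re, smul_eq_mul, mul_sub, mul_add,
    Finset.sum_sub_distrib, Finset.sum_add_distrib, ← Finset.sum_mul, hw1, one_mul]
  ring

/-- X ↦ X^(t/z) is a bijection of the positive definite matrices, and the two objectives differ by a
constant. -/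
theorem isRenyiRightMean_iff (ht : 0 < t) (hz : 0 < z) (hw1 : ∑ j, w j = 1) :
    IsRenyiRightMean t z w A X ↔ IsStrictlyPositive X ∧
      IsMinOn (renyiObjective t z w fun j => A j ^ ((1 - t) / (2 * z)))
        {Y | IsStrictlyPositive Y} (X ^ (t / z)) := by
  rw [IsRenyiRightMean, ← Matrix.isStrictlyPositive_iff_posDef]
  refine and_congr_right fun hX => ?_
  simp only [isMinOn_iff, Set.mem_ofPred_eq]
  constructor
  · intro h Y hY
    have hY' := hY.rpow Y (z / t)
    have h1 := h _ (Matrix.isStrictlyPositive_iff_posDef.1 hY')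
    rw [sum_buresWassersteinDivergence_eq ht hz hw1 hX,
      sum_buresWassersteinDivergence_eq ht hz hw1 hY', CFC.rpow_rpow Y _ _ (by positivity),
      div_mul_div_cancel₀ ht.ne', div_self hz.ne', CFC.rpow_one Y hY.nonneg] at h1
    exact le_of_add_le_add_left h1
  · intro h Y hY
    have hY' := Matrix.isStrictlyPositive_iff_posDef.2 hY
    rw [sum_buresWassersteinDivergence_eq ht hz hw1 hX,
      sum_buresWassersteinDivergence_eq ht hz hw1 hY']
    exact add_le_add_right (h _ (hY'.rpow Y _)) _

theorem exists_isRenyiRightMean (ht : 0 < t) (htz : t ≤ z) (hz : z < 1) (hw : ∀ j, 0 ≤ w j)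
    (hw1 : ∑ j, w j = 1) (hA : ∀ j, IsStrictlyPositive (A j)) :
    ∃ X, IsRenyiRightMean t z w A X := by
  have hz0 := ht.trans_le htz
  obtain ⟨Y, hY, hmin⟩ := exists_isMinOn_renyiObjective ht htz hz hw hw1
    fun j => (hA j).rpow (A j) ((1 - t) / (2 * z))
  refine ⟨Y ^ (z / t), (isRenyiRightMean_iff ht hz0 hw1).2 ⟨hY.rpow Y _, ?_⟩⟩
  rwa [CFC.rpow_rpow Y _ _ (by positivity), div_mul_div_cancel₀ ht.ne', div_self hz0.ne',
    CFC.rpow_one Y hY.nonneg]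

/-- The stationarity equation of the Rényi right mean. -/
theorem IsRenyiRightMean.rpow_eq (hX : IsRenyiRightMean t z w A X) (ht : 0 < t) (htz : t ≤ z)
    (hz : z < 1) (hw : ∀ j, 0 ≤ w j) (hw1 : ∑ j, w j = 1) (hA : ∀ j, IsStrictlyPositive (A j)) :
    X ^ (1 - t / z) =
      ∑ j, w j • powGradient z (A j ^ ((1 - t) / (2 * z))) (X ^ (t / z)) := by
  have hz0 := ht.trans_le htz
  obtain ⟨hXpos, hmin⟩ := (isRenyiRightMean_iff ht hz0 hw1).1 hX
  have h := renyiGradient_eq_zero_of_isMinOn ht htz hz.le hw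
    (fun j => (hA j).rpow (A j) ((1 - t) / (2 * z))) (hXpos.rpow X (t / z)) hmin
  rw [renyiGradient, sub_eq_zero, CFC.rpow_rpow X _ _ (by positivity)] at h
  rw [← h]
  congr 1
  field_simp

theorem rpow_half_exponent_mul_self {ι : Type*} [Fintype ι] [DecidableEq ι] {B : Matrix ι ι ℂ}
    (hB : IsStrictlyPositive B) (a : ℝ) :
    B ^ (a / (2 * z)) * B ^ (a / (2 * z)) = B ^ (a / z) := by
  rw [← CFC.rpow_add hB.isUnit]
  congr 1
  ring

/-- The common source of both lower bounds: stationarity, bounded on each side by replacing X with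
its norm. -/
theorem IsRenyiRightMean.sum_rpow_le (hX : IsRenyiRightMean t z w A X) (ht : 0 < t) (htz : t ≤ z)
    (hz : z < 1) (hw : ∀ j, 0 ≤ w j) (hw1 : ∑ j, w j = 1) (hA : ∀ j, IsStrictlyPositive (A j))
    (hx : 0 < ‖X‖) : ∑ j, w j • A j ^ (1 - t) ≤ ‖X‖ ^ (1 - t) • 1 := by
  have hz0 := ht.trans_le htz
  have hXpos := ((isRenyiRightMean_iff ht hz0 hw1).1 hX).1
  have h0 : X ≤ ‖X‖ • 1 := by
    simpa only [Algebra.algebraMap_eq_smul_one] using hXpos.isSelfAdjoint.le_algebraMap_norm_self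
  have htz1 : t / z ≤ 1 := (div_le_one hz0).2 htz
  have h1 := Matrix.rpow_le_smul_one hXpos.nonneg (s := t / z) (by positivity) h0
  have h2 := Matrix.rpow_le_smul_one hXpos.nonneg (s := 1 - t / z) (by linarith) h0
  rw [hX.rpow_eq ht htz hz hw hw1 hA] at h2
  have h3 : (‖X‖ ^ (t / z)) ^ (z - 1) • ∑ j, w j • A j ^ (1 - t) ≤ ‖X‖ ^ (1 - t / z) • 1 := by
    refine le_trans ?_ h2
    rw [Finset.smul_sum]
    refine Finset.sum_le_sum fun j _ => ?_
    rw [smul_comm]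
    refine smul_le_smul_of_nonneg_left ?_ (hw j)
    have h4 := smul_rpow_le_powGradient ((hA j).rpow (A j) ((1 - t) / (2 * z)))
      (hXpos.rpow X (t / z)) ⟨hz0.le, hz.le⟩ (by positivity) h1
    rwa [rpow_half_exponent_mul_self (hA j), CFC.rpow_rpow _ _ _
      (div_ne_zero (by linarith) hz0.ne'), div_mul_cancel₀ _ hz0.ne'] at h4
  have h5 := smul_le_smul_of_nonneg_left h3
    (show 0 ≤ (‖X‖ ^ (t / z)) ^ (1 - z) by positivity)
  rw [smul_smul, smul_smul, ← Real.rpow_add (by positivity), ← Real.rpow_mul hx.le,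
    ← Real.rpow_mul hx.le, ← Real.rpow_add hx, show t / z * (1 - z + (z - 1)) = 0 by ring,
    Real.rpow_zero, one_smul] at h5
  refine h5.trans_eq ?_
  congr 2
  field_simp
  ring

theorem IsRenyiRightMean.norm_le_quasiArithmeticMean (hX : IsRenyiRightMean t z w A X)
    (ht : 0 < t) (htz : t ≤ z) (hz : z < 1) (hw : ∀ j, 0 ≤ w j) (hw1 : ∑ j, w j = 1)
    (hA : ∀ j, IsStrictlyPositive (A j)) (hx : 0 < ‖X‖) :
    ‖X‖ ≤ ‖quasiArithmeticMean ((1 - t) / z) w A‖ := by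
  have hz0 := ht.trans_le htz
  have ht1 : 0 < 1 - t := by linarith
  have hXpos := ((isRenyiRightMean_iff ht hz0 hw1).1 hX).1
  have hN := isStrictlyPositive_sum_smul hw hw1 fun j => (hA j).rpow (A j) ((1 - t) / z)
  rw [quasiArithmeticMean, CFC.norm_rpow _ (by positivity) hN.nonneg]
  set N := ∑ j, w j • A j ^ ((1 - t) / z) with hNdef
  have hS := hXpos.rpow X (t / (2 * z))
  set S := X ^ (t / (2 * z)) with hSdef
  have hSS : S * S = X ^ (t / z) := rpow_half_exponent_mul_self hXpos t
  have h1 : X = ∑ j, w j • (S * A j ^ ((1 - t) / z) * S) ^ z := by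
    -- Conjugation by S turns the exponent 1 - t/z into 1 and each gradient into a z-th power, ready
    -- for operator concavity.
    have h := congrArg (fun V => S * V * S) (hX.rpow_eq ht htz hz hw hw1 hA)
    simp only [Finset.mul_sum, Finset.sum_mul, mul_smul_comm, smul_mul_assoc, ← hSS] at h
    simp only [conj_powGradient ((hA _).rpow _ _) hS, rpow_half_exponent_mul_self (hA _)] at h
    rw [← h, hSdef, rpow_conj_rpow hXpos]
    conv_lhs => rw [← CFC.rpow_one X hXpos.nonneg]
    congr 1
    field_simp
    ring
  have h2 : X ≤ (S * N * S) ^ z := by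
    have h := (CFC.concaveOn_rpow (A := Matrix (Fin m) (Fin m) ℂ) (p := z)
      ⟨hz0.le, hz.le⟩).le_map_sum (t := Finset.univ) (w := w)
      (p := fun j => S * A j ^ ((1 - t) / z) * S) (fun j _ => hw j) hw1
      (fun j _ => hS.isSelfAdjoint.conjugate_nonneg CFC.rpow_nonneg)
    rw [← h1] at h
    simpa only [hNdef, Finset.mul_sum, Finset.sum_mul, mul_smul_comm, smul_mul_assoc] using h
  have h0 : X ≤ ‖X‖ • 1 := by
    simpa only [Algebra.algebraMap_eq_smul_one] using hXpos.isSelfAdjoint.le_algebraMap_norm_self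
  have h3 : S * N * S ≤ (‖N‖ * ‖X‖ ^ (t / z)) • 1 := by
    have hN1 : N ≤ ‖N‖ • 1 := by
      simpa only [Algebra.algebraMap_eq_smul_one] using hN.isSelfAdjoint.le_algebraMap_norm_self
    refine (hS.isSelfAdjoint.conjugate_le_conjugate hN1).trans ?_
    rw [mul_smul_comm, mul_one, smul_mul_assoc, hSS, mul_smul]
    exact smul_le_smul_of_nonneg_left
      (Matrix.rpow_le_smul_one hXpos.nonneg (by positivity) h0) (norm_nonneg N)
  have h4 := h2.trans (Matrix.rpow_le_smul_one
    (hS.isSelfAdjoint.conjugate_nonneg hN.nonneg) hz0.le h3)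
  rw [← Algebra.algebraMap_eq_smul_one, ← CStarAlgebra.norm_le_iff_le_algebraMap X (by positivity)
    hXpos.nonneg, Real.mul_rpow (norm_nonneg N) (by positivity), ← Real.rpow_mul hx.le,
    div_mul_cancel₀ _ hz0.ne'] at h4
  have h5 : ‖X‖ ^ (1 - t) ≤ ‖N‖ ^ z := by
    rwa [Real.rpow_sub hx, Real.rpow_one, div_le_iff₀ (by positivity)]
  have h6 := Real.rpow_le_rpow (by positivity) h5 (inv_nonneg.2 ht1.le)
  rw [Real.rpow_rpow_inv hx.le ht1.ne', ← Real.rpow_mul (norm_nonneg N)] at h6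
  refine h6.trans_eq ?_
  congr 1
  field_simp

/-- The harmonic-type quasi-arithmetic mean is bounded by `c` as soon as
`∑ⱼ wⱼ Aⱼ ^ (1 - t) ≤ c ^ (1 - t)`. -/
theorem norm_quasiArithmeticMean_le (ht1 : t < 1) (hz0 : 0 < z) (hz : z ≤ 1) (hw : ∀ j, 0 ≤ w j)
    (hw1 : ∑ j, w j = 1) (hA : ∀ j, IsStrictlyPositive (A j)) {c : ℝ} (hc : 0 ≤ c)
    (h : ∑ j, w j • A j ^ (1 - t) ≤ c ^ (1 - t) • 1) :
    ‖quasiArithmeticMean ((t - 1) / z) w A‖ ≤ c := by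
  have ht1' : 0 < 1 - t := by linarith
  have hD := isStrictlyPositive_sum_smul hw hw1 fun j => (hA j).rpow (A j) ((t - 1) / z)
  have hE := isStrictlyPositive_sum_smul hw hw1 fun j => (hA j).rpow (A j) (1 - t)
  have h1 : (∑ j, w j • A j ^ (1 - t)) ^ (-1 : ℝ) ≤ ∑ j, w j • A j ^ (t - 1) := by
    have h := (CStarAlgebra.convexOn_ringInverse (A := Matrix (Fin m) (Fin m) ℂ)).map_sum_le
      (t := Finset.univ) (w := w) (p := fun j => A j ^ (1 - t)) (fun j _ => hw j) hw1
      (fun j _ => (hA j).rpow _ _)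
    rw [CFC.inverse_eq_rpow_neg_one hE] at h
    refine h.trans_eq (Finset.sum_congr rfl fun j _ => ?_)
    rw [CFC.inverse_rpow _ _ ht1'.ne' (hA j), neg_sub]
  have h2 : ∑ j, w j • A j ^ (t - 1) ≤ (∑ j, w j • A j ^ ((t - 1) / z)) ^ z := by
    have h := (CFC.concaveOn_rpow (A := Matrix (Fin m) (Fin m) ℂ) (p := z)
      ⟨hz0.le, hz⟩).le_map_sum (t := Finset.univ) (w := w)
      (p := fun j => A j ^ ((t - 1) / z)) (fun j _ => hw j) hw1
      (fun j _ => Set.mem_Ici.2 CFC.rpow_nonneg)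
    refine Eq.trans_le (Finset.sum_congr rfl fun j _ => ?_) h
    rw [CFC.rpow_rpow _ _ _ (div_ne_zero (by linarith) hz0.ne') (hA j), div_mul_cancel₀ _ hz0.ne']
  -- Inverting gives D^(-z) ≤ E for D = ∑ w_j A_j^((t-1)/z) and E = ∑ w_j A_j^(1-t); the norm of
  -- D^(-z) is that of the mean to the power 1 - t.
  have h3 := CStarAlgebra.rpow_neg_one_le_rpow_neg_one (h1.trans h2) (hE.rpow _ _)
  rw [CFC.rpow_rpow _ _ _ (by norm_num) hE, CFC.rpow_rpow _ _ _ hz0.ne' hD, neg_mul_neg, one_mul,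
    CFC.rpow_one _ hE.nonneg] at h3
  have h4 := h3.trans h
  rw [← Algebra.algebraMap_eq_smul_one, ← CStarAlgebra.norm_le_iff_le_algebraMap _ (by positivity)
    CFC.rpow_nonneg] at h4
  have h5 := Real.rpow_le_rpow (norm_nonneg _) h4 (inv_nonneg.2 ht1'.le)
  rw [Real.rpow_rpow_inv hc ht1'.ne', ← CFC.norm_rpow _ (inv_pos.2 ht1') CFC.rpow_nonneg,
    CFC.rpow_rpow _ _ _ (by linarith) hD] at h5
  rw [quasiArithmeticMean]
  convert h5 using 3
  have : t - 1 ≠ 0 := by linarith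
  field_simp
  ring

end RenyiRightMean

theorem theoremT {m n : ℕ} (t z : ℝ) (ht : 0 < t) (htz : t ≤ z) (hz : z < 1)
    (w : Fin n → ℝ) (hw : ∀ j, 0 < w j) (hw1 : ∑ j, w j = 1)
    (A : Fin n → Matrix (Fin m) (Fin m) ℂ) (hA : ∀ j, (A j).PosDef) :
    ‖powerMean (1 - t) w A‖ ≤ ‖renyiRightMean t z w A‖ ∧
    ‖renyiRightMean t z w A‖ ≤ ‖quasiArithmeticMean ((1 - t) / z) w A‖ ∧
    ‖quasiArithmeticMean ((t - 1) / z) w A‖ ≤ ‖renyiRightMean t z w A‖ := by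
  -- For m = 0 all matrices coincide; otherwise the Rényi mean has positive norm, as the estimates
  -- require.
  rcases isEmpty_or_nonempty (Fin m) with hm | hm
  · exact ⟨(congrArg norm (Subsingleton.elim _ _)).le, (congrArg norm (Subsingleton.elim _ _)).le,
      (congrArg norm (Subsingleton.elim _ _)).le⟩
  have hA' := fun j => Matrix.isStrictlyPositive_iff_posDef.2 (hA j)
  have hw' := fun j => (hw j).le
  have hX : IsRenyiRightMean t z w A (renyiRightMean t z w A) :=
    Classical.epsilon_spec (exists_isRenyiRightMean ht htz hz hw' hw1 hA')
  have hP : IsPowerMean (1 - t) w A (powerMean (1 - t) w A) :=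
    Classical.epsilon_spec (exists_isPowerMean ⟨by linarith, by linarith⟩ hw' hw1 hA')
  have hx : 0 < ‖renyiRightMean t z w A‖ := norm_pos_iff.2 hX.1.isUnit.ne_zero
  have hsum := hX.sum_rpow_le ht htz hz hw' hw1 hA' hx
  exact ⟨hP.norm_le ⟨by linarith, by linarith⟩ hw' hA' hx.le hsum,
    hX.norm_le_quasiArithmeticMean ht htz hz hw' hw1 hA' hx,
    norm_quasiArithmeticMean_le (by linarith) (ht.trans_le htz) hz.le hw' hw1 hA' hx.le hsum⟩
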